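/- Let $G=(V,E)$ be a finite simple graph with $n$ vertices and maximum degree $\Delta$, and let $\epsilon\in[0,1]$. Call an edge $uv$ a friend edge if $|N(u)\cap N(v)|\ge(1-\epsilon)\Delta$, and call a vertex dense if it is incident to at least $(1-\epsilon)\Delta$ friend edges. The almost-cliques are the connected components of the graph formed by the dense vertices and the friend edges between them. Every vertex $v$ has a finite list $\operatorname{Pal}_{\mathrm{init}}(v)$ of at least $\Delta+1$ colors, the vertices have distinct IDs, and every almost-clique $C_j$ has a leader $\ell_j\in C_j$. Let a proper partial list-coloring $\chi$ of $G$ be given. For a dense vertex $v$ in the almost-clique $C_j$, let the anti-degree $a(v)$ be the number of uncolored vertices of $C_j$ not adjacent to $v$ (including $v$ itself if it is uncolored), let the external degree $\bar d(v)$ be the number of uncolored dense neighbors of $v$ outside $C_j$, let $\operatorname{Pal}(v)$ be the set of colors of $\operatorname{Pal}_{\mathrm{init}}(v)$ not used by a neighbor of $v$, and let $Q(v)=|\operatorname{Pal}(v)|$. The dense coloring step with parameter $\gamma\in[0,1]$ is the following random process. Independently for each almost-clique $C_j$, let $\pi_j$ be a uniformly random permutation of its $M_j$ uncolored vertices. For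 $k=1,\dots,\lceil\gamma M_j\rceil$ in this order, the vertex $v=\pi_j(k)$ picks a tentative color $A(v)$ uniformly at random from $\operatorname{Pal}(v)\setminus\{A(\pi_j(1)),\dots,A(\pi_j(k-1))\}$ (and no color if this set is empty). Then each $v\in C_j$ that has picked a color is permanently colored with $A(v)$, unless it has a neighbor $w$ in some almost-clique $C_{j'}$ with $\mathrm{ID}(\ell_{j'})<\mathrm{ID}(\ell_j)$ and $A(w)=A(v)$; in that case $v$ remains uncolored. All other vertices keep their state. Let $a'(v),\bar d'(v),Q'(v)$ denote the anti-degree, external degree and palette size with respect to the partial coloring after the step. Claim: for every constant $K'>0$ there is a constant $K_0>0$, depending only on $K'$, such that the following holds for every $K\ge K_0$ and all data as above. Let $D,Z>0$ be real numbers and put $\delta=D/Z$. Suppose that the regularity conditions $D\delta\ge K\ln n$ and $\delta\le 1/K$ hold, and that every uncolored dense vertex $v$ satisfies $$a(v)\le D,\qquad \bar d(v)\le D,\qquad Q(v)\ge Z .$$ Then, after one dense coloring step with $\gamma=1-2\sqrt\delta$, with probability at least $1-n^{-K'}$, all dense vertices $v$ that were uncolored before the step simultaneously satisfy $$a'(v)\le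 12D\sqrt\delta,\qquad \bar d'(v)\le 12D\sqrt\delta,\qquad Q'(v)\ge D/\sqrt\delta .$$ -/

import Mathlib

open scoped ENNReal

namespace DenseColoring

/-! ### Products of discrete distributions -/

theorem tsum_pi_prod_eq_one {ι : Type*} [Fintype ι] :
    ∀ {β : ι → Type*} (p : ∀ i, PMF (β i)), ∑' f : (∀ i, β i), ∏ i, p i (f i) = 1 := by
  refine Fintype.induction_empty_option
    (P := fun ι _ => ∀ {β : ι → Type _} (p : ∀ i, PMF (β i)),
      ∑' f : (∀ i, β i), ∏ i, p i (f i) = 1) ?_ ?_ ?_ ι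
  · intro α α' _ e ih β p
    let _ : Fintype α := Fintype.ofEquiv α' e.symm
    rw [← ih (fun a => p (e a)), ← (Equiv.piCongrLeft β e).tsum_eq]
    refine tsum_congr fun f => ?_
    rw [← e.prod_comp]
    refine Finset.prod_congr rfl fun a _ => ?_
    rw [Equiv.piCongrLeft_apply_apply]
  · intro β p
    simp
  · intro α _ ih β p
    rw [← (Equiv.piOptionEquivProd (β := β)).symm.tsum_eq, ENNReal.tsum_prod']
    simp only [Fintype.prod_option, Equiv.piOptionEquivProd]
    simp [ENNReal.tsum_mul_left, ih (fun a => p (some a)), (p none).tsum_coe]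

/-- The joint law of finitely many independent discrete random variables with laws `p i`. -/
noncomputable def productPMF {ι : Type*} [Fintype ι] {β : ι → Type*} (p : ∀ i, PMF (β i)) :
    PMF (∀ i, β i) :=
  ⟨fun f => ∏ i, p i (f i), by
    have h := tsum_pi_prod_eq_one p
    rw [← h]
    exact ENNReal.summable.hasSum⟩

/-! ### The decomposition into sparse vertices and almost-cliques -/

section Decomposition

variable {V : Type*} [Fintype V]

open Classical in
/-- The maximum degree `Δ` of `G`. -/
noncomputable def maxDeg (G : SimpleGraph V) : ℕ := G.maxDegree

/-- `uv` is a friend edge: `u` and `v` are adjacent and share at least `(1 - ε) Δ` neighbors. -/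
def IsFriend (G : SimpleGraph V) (ε : ℝ) (u v : V) : Prop :=
  G.Adj u v ∧ (1 - ε) * (maxDeg G : ℝ) ≤ ((G.commonNeighbors u v).ncard : ℝ)

/-- `v` is dense: it has at least `(1 - ε) Δ` friends. -/
def IsDense (G : SimpleGraph V) (ε : ℝ) (v : V) : Prop :=
  (1 - ε) * (maxDeg G : ℝ) ≤ ({u : V | IsFriend G ε v u}.ncard : ℝ)

/-- The set of dense vertices, as a type. -/
abbrev DenseVertex (G : SimpleGraph V) (ε : ℝ) : Type _ := {v : V // IsDense G ε v}

/-- The graph of the friend edges between dense vertices. -/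
def friendGraph (G : SimpleGraph V) (ε : ℝ) : SimpleGraph (DenseVertex G ε) where
  Adj u v := IsFriend G ε u.1 v.1
  symm := ⟨fun u v h => ⟨h.1.symm, by rw [SimpleGraph.commonNeighbors_symm]; exact h.2⟩⟩
  loopless := ⟨fun u h => G.loopless.irrefl u.1 h.1⟩

/-- The almost-cliques `C_1, …, C_k`: the connected components of the friend graph. -/
abbrev AlmostClique (G : SimpleGraph V) (ε : ℝ) : Type _ := (friendGraph G ε).ConnectedComponent

noncomputable instance (G : SimpleGraph V) (ε : ℝ) : Fintype (AlmostClique G ε) :=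
  Fintype.ofFinite _

/-- The almost-clique that contains the dense vertex `v`. -/
abbrev cliqueOf {G : SimpleGraph V} {ε : ℝ} (v : DenseVertex G ε) : AlmostClique G ε :=
  (friendGraph G ε).connectedComponentMk v

end Decomposition

/-! ### Partial list-colorings and the residual quantities

A partial coloring is a map `χ : V → Option Col`; the value `none` is the blank color, so
`χ v = none` says that `v` is uncolored, i.e. belongs to the residual graph. -/

section Residual

variable {V Col : Type*} [Fintype V]

/-- `χ` is a proper partial list-coloring: colored vertices have a color of their own list, and
adjacent vertices never have the same (non-blank) color. -/
def IsPartialColoring (G : SimpleGraph V) (pal : V → Finset Col) (χ : V → Option Col) : Prop :=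
  (∀ v c, χ v = some c → c ∈ pal v) ∧
    ∀ v w c, G.Adj v w → χ v = some c → χ w ≠ some c

open Classical in
/-- The residual palette of `v`: the colors of its list that no neighbor has taken. -/
noncomputable def resPalette (G : SimpleGraph V) (pal : V → Finset Col) (χ : V → Option Col)
    (v : V) : Finset Col :=
  (pal v).filter fun c => ∀ w, G.Adj v w → χ w ≠ some c

open Classical in
/-- The residual almost-clique: the uncolored vertices of the component `C`. -/
noncomputable def resClique {G : SimpleGraph V} {ε : ℝ} (χ : V → Option Col)
    (C : AlmostClique G ε) : Finset (DenseVertex G ε) :=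
  Finset.univ.filter fun v => cliqueOf v = C ∧ χ v.1 = none

open Classical in
/-- The anti-degree `|C_j \ N(v)|` of a dense vertex `v ∈ C_j` in the residual graph. -/
noncomputable def antiDegree {G : SimpleGraph V} {ε : ℝ} (χ : V → Option Col)
    (v : DenseVertex G ε) : ℕ :=
  ((resClique χ (cliqueOf v)).filter fun w => ¬ G.Adj v.1 w.1).card

open Classical in
/-- The external degree of a dense vertex `v ∈ C_j` in the residual graph: the number of uncolored
dense neighbors of `v` outside `C_j`. -/
noncomputable def extDegree {G : SimpleGraph V} {ε : ℝ} (χ : V → Option Col)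
    (v : DenseVertex G ε) : ℕ :=
  (Finset.univ.filter fun w : DenseVertex G ε =>
    χ w.1 = none ∧ G.Adj v.1 w.1 ∧ cliqueOf w ≠ cliqueOf v).card

end Residual

/-! ### The dense coloring step -/

section Step

variable {V Col : Type*} [Fintype V]

/-- A uniformly random element of `S`, and the blank color if `S` is empty. -/
noncomputable def pickColor (S : Finset Col) : PMF (Option Col) := by
  classical
  exact if h : S.Nonempty then (PMF.uniformOfFinset S h).map some else PMF.pure none

open Classical in
/-- Process the vertices of a list in order: each of them picks a uniformly random color of its
palette that is not among the tentative colors picked so far. -/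
noncomputable def pickInOrder {W : Type*} (Q : W → Finset Col) :
    List W → (W → Option Col) → PMF (W → Option Col)
  | [], A => PMF.pure A
  | v :: l, A =>
      (pickColor ((Q v).filter fun c => ∀ w, A w ≠ some c)).bind fun a =>
        pickInOrder Q l (Function.update A v a)

open Classical in
instance {W : Type*} (S : Finset W) : Nonempty (Fin S.card ≃ {w : W // w ∈ S}) :=
  ⟨S.equivFin.symm⟩

open Classical in
/-- The law of the tentative colors of one (residual) almost-clique `S` with palettes `Q`: order
`S` by a uniformly random permutation `π`, and let the first `⌈|S| γ⌉` vertices `π 0, π 1, …`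
pick their colors in this order. All other vertices get the blank color. -/
noncomputable def cliqueLaw {W : Type*} (Q : W → Finset Col) (γ : ℝ) (S : Finset W) :
    PMF (W → Option Col) :=
  (PMF.uniformOfFintype (Fin S.card ≃ {w : W // w ∈ S})).bind fun π =>
    pickInOrder Q ((List.ofFn fun k => (π k).1).take ⌈(S.card : ℝ) * γ⌉₊) fun _ => none

/-- The joint law of all the tentative colors; distinct almost-cliques act independently. -/
noncomputable def tentativeLaw (G : SimpleGraph V) (ε : ℝ) (pal : V → Finset Col)
    (χ : V → Option Col) (γ : ℝ) : PMF (DenseVertex G ε → Option Col) :=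
  (productPMF fun C : AlmostClique G ε =>
    cliqueLaw (fun v : DenseVertex G ε => resPalette G pal χ v.1) γ (resClique χ C)).map
      fun A v => A (cliqueOf v) v

open Classical in
/-- The coloring after the step, given the tentative colors `A`: an uncolored dense vertex `v`
commits to `A v`, unless a dense neighbor in an almost-clique whose leader has a smaller ID chose
the same color. All other vertices keep their state. -/
noncomputable def commit {G : SimpleGraph V} {ε : ℝ} (ID : V → ℕ)
    (leader : AlmostClique G ε → DenseVertex G ε) (χ : V → Option Col)
    (A : DenseVertex G ε → Option Col) (v : V) : Option Col :=
  if χ v ≠ none then χ v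
  else if h : IsDense G ε v then
    if ∃ w : DenseVertex G ε, G.Adj v w.1 ∧ A w = A ⟨v, h⟩ ∧
        ID (leader (cliqueOf w)).1 < ID (leader (cliqueOf (⟨v, h⟩ : DenseVertex G ε))).1
    then none
    else A ⟨v, h⟩
  else none

/-- The law of the partial coloring at the end of a dense coloring step with parameter `γ` that
starts from the partial coloring `χ`. -/
noncomputable def denseStep (G : SimpleGraph V) (ε : ℝ) (pal : V → Finset Col) (ID : V → ℕ)
    (leader : AlmostClique G ε → DenseVertex G ε) (γ : ℝ) (χ : V → Option Col) :
    PMF (V → Option Col) :=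
  (tentativeLaw G ε pal χ γ).map (commit ID leader χ)

end Step

end DenseColoring

namespace DenseColoring

/-! ### Bounds for discrete distributions -/

/-! Write `s = √δ`, so that `D = s ^ 2 * Z` and `γ = 1 - 2 * s`. An uncolored dense vertex can stay
uncolored for two reasons only. Either it comes too late in the permutation, which happens to a
fraction of at most `2 * s` of its clique, or its tentative color was also chosen by an external
neighbor of smaller leader ID. In the second case at most `D` colors are dangerous, while at least
`s * Z` colors are available at every pick, so the chance is at most `D / (s * Z) = s`.

These events are not independent, but they multiply as if they were: a fixed set `T` stays uncolored
with probability at most `(3 * s) ^ T.card`. Inside a clique this follows by revealing the picks in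
order (`pickInOrder_forall_le`) and then averaging over the permutation (`lateCount_le`,
`cliqueLaw_forall_le`). Across cliques, conflicts only point to smaller leader IDs, so the cliques
can be exposed in that order (`productPMF_forall_mem_le`). The product bound is
`tentativeLaw_forall_commit_eq_none_le`.

A union bound over subsets turns the product bound into an upper tail: among at most `D` vertices,
more than `12 * D * s` stay uncolored with probability at most `exp (-4 * D * s)`. Since `D * s ≥ D
* δ ≥ K * log n`, a union bound over all vertices and both degrees succeeds.

The palette bound is deterministic. A palette loses at most one color per external neighbor and one
per vertex that picks in its own clique, and lists of more than `Δ` colors make the palette nearly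
as large as the clique (`card_resClique_lt`). -/

theorem toOuterMeasure_bind_le {α β : Type*} (p : PMF α) (f : α → PMF β) (s : Set β) (c : ℝ≥0∞)
    (h : ∀ a ∈ p.support, (f a).toOuterMeasure s ≤ c) : (p.bind f).toOuterMeasure s ≤ c := by
  rw [PMF.toOuterMeasure_bind_apply]
  calc ∑' a, p a * (f a).toOuterMeasure s ≤ ∑' a, p a * c := by
        refine ENNReal.tsum_le_tsum fun a => ?_
        by_cases ha : p a = 0
        · simp [ha]
        · gcongr
          exact h a ((p.mem_support_iff a).2 ha)
    _ = c := by rw [ENNReal.tsum_mul_right, p.tsum_coe, one_mul]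

theorem toOuterMeasure_bind_le_mul {α β : Type*} (p : PMF α) (f : α → PMF β) (s : Set β)
    (t : Set α) (c : ℝ≥0∞) (h : ∀ a ∈ p.support, a ∈ t → (f a).toOuterMeasure s ≤ c)
    (h' : ∀ a ∈ p.support, a ∉ t → (f a).toOuterMeasure s = 0) :
    (p.bind f).toOuterMeasure s ≤ p.toOuterMeasure t * c := by
  rw [PMF.toOuterMeasure_bind_apply, PMF.toOuterMeasure_apply, ← ENNReal.tsum_mul_right]
  refine ENNReal.tsum_le_tsum fun a => ?_
  by_cases ha : p a = 0
  · simp [ha]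
  have ha := (p.mem_support_iff a).2 ha
  by_cases hat : a ∈ t
  · rw [Set.indicator_of_mem hat]
    gcongr
    exact h a ha hat
  · simp [h' a ha hat]

theorem toOuterMeasure_univ {α : Type*} (p : PMF α) : p.toOuterMeasure Set.univ = 1 :=
  (p.toOuterMeasure_apply_eq_one_iff _).2 (Set.subset_univ _)

theorem toOuterMeasure_le_one {α : Type*} (p : PMF α) (s : Set α) : p.toOuterMeasure s ≤ 1 :=
  (toOuterMeasure_univ p) ▸ p.toOuterMeasure.mono (Set.subset_univ s)

theorem one_sub_toOuterMeasure_compl_le {α : Type*} (p : PMF α) (s : Set α) :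
    1 - (p.toOuterMeasure sᶜ).toReal ≤ (p.toOuterMeasure s).toReal := by
  have h : (1 : ℝ≥0∞) ≤ p.toOuterMeasure s + p.toOuterMeasure sᶜ := by
    rw [← toOuterMeasure_univ p, ← Set.union_compl_self s]
    exact MeasureTheory.measure_union_le _ _
  have h1 : p.toOuterMeasure s ≠ ∞ := ne_top_of_le_ne_top (by simp) (toOuterMeasure_le_one p s)
  have h2 : p.toOuterMeasure sᶜ ≠ ∞ := ne_top_of_le_ne_top (by simp) (toOuterMeasure_le_one p _)
  have := ENNReal.toReal_mono (ENNReal.add_ne_top.2 ⟨h1, h2⟩) h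
  rw [ENNReal.toReal_add h1 h2] at this
  simp at this
  linarith

/-! ### Products -/

open Classical in
-- Resampling one coordinate from its own law does not change a product law. This is how one
-- conditions on all coordinates but `i`.
theorem productPMF_eq_bind_update {ι : Type*} [Fintype ι] {β : ι → Type*} (p : ∀ i, PMF (β i))
    (i : ι) :
    productPMF p = (productPMF p).bind fun f => (p i).map (Function.update f i) := by
  ext g
  have hprod : ∀ b, productPMF p (Function.update g i b)
      = p i b * ∏ j ∈ Finset.univ.erase i, p j (g j) := by
    intro b
    change ∏ j, p j (Function.update g i b j) = _
    rw [← Finset.mul_prod_erase _ _ (Finset.mem_univ i), Function.update_self]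
    congr 1
    refine Finset.prod_congr rfl fun j hj => ?_
    rw [Function.update_of_ne (Finset.ne_of_mem_erase hj)]
  have hmap : ∀ f, productPMF p f * ((p i).map (Function.update f i)) g
      = ∑' b, if f = Function.update g i b then productPMF p f * p i (g i) else 0 := by
    intro f
    rw [PMF.map_apply]
    by_cases h : f = Function.update g i (f i)
    · rw [tsum_eq_single (g i), tsum_eq_single (f i), if_pos h, if_pos]
      · rw [h]; simp
      · intro b hb
        rw [if_neg]
        intro h'
        apply hb
        rw [h']; simp
      · intro b hb
        rw [if_neg]
        intro h'
        apply hb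
        rw [h']; simp
    · rw [ENNReal.tsum_eq_zero.2, ENNReal.tsum_eq_zero.2, mul_zero]
      · intro b
        rw [if_neg]
        intro h'
        apply h
        rw [h']; simp
      · intro b
        rw [if_neg]
        intro h'
        apply h
        rw [h']; simp
  rw [PMF.bind_apply]
  simp_rw [hmap]
  rw [ENNReal.tsum_comm]
  simp_rw [tsum_ite_eq, hprod]
  rw [ENNReal.tsum_mul_right, ENNReal.tsum_mul_right, (p i).tsum_coe]
  have := hprod (g i)
  rw [Function.update_eq_self] at this
  rw [this, one_mul, mul_comm]

theorem mem_support_of_mem_support_productPMF {ι : Type*} [Fintype ι] {β : ι → Type*}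
    {p : ∀ i, PMF (β i)} {f : ∀ i, β i} (hf : f ∈ (productPMF p).support) (i : ι) :
    f i ∈ (p i).support := by
  rw [PMF.mem_support_iff] at hf ⊢
  exact fun h => hf (Finset.prod_eq_zero (Finset.mem_univ i) h)

open Classical in
/-- If the event `E i` is determined by the coordinates of rank at most `r i` and has conditional
probability at most `q i` given the coordinates other than `i`, then the intersection of these
events has probability at most the product of the `q i`. -/
theorem productPMF_forall_mem_le {ι : Type*} [Fintype ι] {β : ι → Type*} (p : ∀ i, PMF (β i))
    (r : ι → ℕ) (hr : Function.Injective r) (E : ι → Set (∀ i, β i)) (q : ι → ℝ≥0∞)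
    (hE : ∀ i f g, (∀ j, r j ≤ r i → f j = g j) → f ∈ E i → g ∈ E i)
    (hq : ∀ i f, (p i).toOuterMeasure {b | Function.update f i b ∈ E i} ≤ q i) (s : Finset ι) :
    (productPMF p).toOuterMeasure {f | ∀ i ∈ s, f ∈ E i} ≤ ∏ i ∈ s, q i := by
  induction s using Finset.induction_on_max_value r with
  | empty => simpa using toOuterMeasure_le_one _ _
  | insert i s his hmax ih =>
    rw [Finset.prod_insert his, mul_comm]
    refine le_trans ?_ (mul_le_mul_left ih _)
    -- Resample the coordinate of largest rank: the events indexed by `s` do not see it, so only `E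
    -- i` is affected and contributes the factor `q i`.
    conv_lhs => rw [productPMF_eq_bind_update p i]
    refine toOuterMeasure_bind_le_mul _ _ _ _ _ ?_ ?_
    · intro f _ _
      rw [PMF.toOuterMeasure_map_apply]
      refine le_trans ((p i).toOuterMeasure.mono ?_) (hq i f)
      intro b hb
      exact hb i (Finset.mem_insert_self _ _)
    · intro f _ hf
      rw [PMF.toOuterMeasure_map_apply]
      rw [← MeasureTheory.measure_empty (μ := (p i).toOuterMeasure)]
      congr 1
      refine Set.eq_empty_of_forall_notMem fun b hb => hf fun j hj => ?_
      refine hE j _ _ ?_ (hb j (Finset.mem_insert_of_mem hj))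
      intro k hk
      rw [Function.update_of_ne]
      rintro rfl
      have : k = j := hr (le_antisymm hk (hmax j hj))
      exact his (this ▸ hj)

/-! ### The tentative colors of one almost-clique -/

theorem pickInOrder_support_of_notMem {Col W : Type*} (Q : W → Finset Col) (l : List W) :
    ∀ (A : W → Option Col), ∀ f ∈ (pickInOrder Q l A).support, ∀ v ∉ l, f v = A v := by
  classical
  induction l with
  | nil =>
    intro A f hf v _
    simp only [pickInOrder, PMF.support_pure, Set.mem_singleton_iff] at hf
    rw [hf]
  | cons u l ih =>
    intro A f hf v hv
    simp only [pickInOrder, PMF.mem_support_bind_iff] at hf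
    obtain ⟨a, -, ha⟩ := hf
    rw [List.mem_cons, not_or] at hv
    rw [ih _ f (by convert ha) v hv.2, Function.update_of_ne hv.1]

theorem pickColor_toOuterMeasure_le {Col : Type*} (S F : Finset Col) (x : ℝ≥0∞)
    (hS : S.Nonempty) (h : (F.card : ℝ≥0∞) ≤ x * S.card) :
    (pickColor S).toOuterMeasure {a | ∀ c, a = some c → c ∈ F} ≤ x := by
  classical
  rw [pickColor, dif_pos hS, PMF.toOuterMeasure_map_apply,
    PMF.toOuterMeasure_uniformOfFinset_apply]
  refine ENNReal.div_le_of_le_mul (le_trans ?_ h)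
  gcongr
  intro c hc
  simpa using (Finset.mem_filter.1 hc).2

/-- Reveal the picks one by one. `B` contains the vertices that have already picked, and the budget
`B.card + l.length ≤ N` leaves at most `N - 1` colors removed at each pick. So at least `(Q v).card
+ 1 - N` colors remain, and every vertex of `T` costs a conditional factor `x`, whatever happened
before. -/
theorem pickInOrder_forall_le {Col W : Type*} [Fintype W] (Q F : W → Finset Col) (x : ℝ≥0∞)
    (N : ℕ) (l : List W) (hl : l.Nodup) (hQ : ∀ v ∈ l, N ≤ (Q v).card)
    (hF : ∀ v ∈ l, ((F v).card : ℝ≥0∞) ≤ x * ((Q v).card + 1 - N : ℕ)) :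
    ∀ (A : W → Option Col) (B : Finset W), (∀ w, A w ≠ none → w ∈ B) → B.card + l.length ≤ N →
    ∀ T : Finset W, (∀ v ∈ T, v ∈ l) →
    (pickInOrder Q l A).toOuterMeasure {f | ∀ v ∈ T, ∀ c, f v = some c → c ∈ F v}
      ≤ x ^ T.card := by
  classical
  induction l with
  | nil =>
    intro A B _ _ T hT
    have : T = ∅ := Finset.eq_empty_of_forall_notMem fun v hv => by simpa using hT v hv
    subst this
    simpa using toOuterMeasure_le_one _ _
  | cons u l ih =>
    intro A B hB hN T hT
    have ih' := ih hl.of_cons (fun v hv => hQ v (List.mem_cons_of_mem _ hv))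
      (fun v hv => hF v (List.mem_cons_of_mem _ hv))
    have hB' : ∀ a w, Function.update A u a w ≠ none → w ∈ insert u B := by
      intro a w hw
      by_cases h : w = u
      · simp [h]
      · rw [Function.update_of_ne h] at hw
        exact Finset.mem_insert_of_mem (hB w hw)
    have hN' : (insert u B).card + l.length ≤ N := by
      have := Finset.card_insert_le u B
      simp only [List.length_cons] at hN
      omega
    rw [pickInOrder]
    by_cases huT : u ∈ T
    · have hcard : T.card = (T.erase u).card + 1 := (Finset.card_erase_add_one huT).symm
      rw [hcard, pow_succ, mul_comm]
      set S := (Q u).filter fun c => ∀ w, A w ≠ some c with hS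
      have hScard : (Q u).card + 1 - N ≤ S.card := by
        have h1 : Q u ⊆ S ∪ B.biUnion fun w => (A w).toFinset := by
          intro c hc
          by_cases h : ∀ w, A w ≠ some c
          · exact Finset.mem_union_left _ (Finset.mem_filter.2 ⟨hc, h⟩)
          · push Not at h
            obtain ⟨w, hw⟩ := h
            refine Finset.mem_union_right _ (Finset.mem_biUnion.2 ⟨w, hB w (by simp [hw]), ?_⟩)
            simp [hw]
        have h2 : (B.biUnion fun w => (A w).toFinset).card ≤ B.card * 1 := by
          refine Finset.card_biUnion_le_card_mul _ _ _ fun w _ => ?_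
          cases A w <;> simp
        have h3 := (Finset.card_le_card h1).trans (Finset.card_union_le _ _)
        simp only [List.length_cons] at hN
        omega
      have hSne : S.Nonempty := by
        have := hQ u List.mem_cons_self
        exact Finset.card_pos.1 (by omega)
      refine le_trans (toOuterMeasure_bind_le_mul _ _ _ {a | ∀ c, a = some c → c ∈ F u}
        (x ^ (T.erase u).card) ?_ ?_) ?_
      · intro a _ _
        refine le_trans (PMF.toOuterMeasure_mono _ ?_)
          (ih' (Function.update A u a) (insert u B) (hB' a) hN' (T.erase u) ?_)
        · rintro f ⟨hf, -⟩ v hv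
          exact hf v (Finset.mem_of_mem_erase hv)
        · intro v hv
          have := hT v (Finset.mem_of_mem_erase hv)
          simpa [Finset.ne_of_mem_erase hv] using this
      · intro a _ ha
        -- A pick outside `F u` is final, because `u` does not occur again in `l`; the event is then
        -- impossible.
        rw [PMF.toOuterMeasure_apply_eq_zero_iff, Set.disjoint_left]
        intro f hf hf'
        apply ha
        have := pickInOrder_support_of_notMem Q l _ f hf u (List.nodup_cons.1 hl).1
        rw [Function.update_self] at this
        intro c hc
        exact hf' u huT c (this.trans hc)
      · gcongr
        have hpick : ∀ S', S' = S → (pickColor S').toOuterMeasure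
            {a | ∀ c, a = some c → c ∈ F u} ≤ x := by
          rintro _ rfl
          refine pickColor_toOuterMeasure_le S (F u) x hSne
            ((hF u List.mem_cons_self).trans ?_)
          gcongr
        exact hpick _ (by rw [hS]; congr!)
    · refine toOuterMeasure_bind_le _ _ _ _ fun a _ => ?_
      refine ih' (Function.update A u a) (insert u B) (hB' a) hN' T ?_
      intro v hv
      have := hT v hv
      rcases List.mem_cons.1 this with h | h
      · exact absurd (h ▸ hv) huT
      · exact h

open Classical in
/-- The number of orderings of `S` in which no element of `T` is among the first `N`. -/
noncomputable def lateCount {W : Type*} (S : Finset W) (N : ℕ) (T : Finset {w : W // w ∈ S}) : ℕ :=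
  (Finset.univ.filter fun π : Fin S.card ≃ {w : W // w ∈ S} =>
    ∀ v ∈ T, N ≤ (π.symm v : ℕ)).card

open Classical in
-- By symmetry the count is the same for every `v ∉ T` in place of `u`. Summing over these `v`
-- counts, for each ordering with `T` late, the late elements outside `T`; there are `S.card - N -
-- T.card` of them.
theorem lateCount_insert {W : Type*} (S : Finset W) (N : ℕ) (hN : N ≤ S.card)
    (T : Finset {w : W // w ∈ S}) (u : {w : W // w ∈ S}) (hu : u ∉ T) :
    (S.card - T.card) * lateCount S N (insert u T) ≤ (S.card - N - T.card) * lateCount S N T := by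
  have hsym : ∀ v ∈ Tᶜ, lateCount S N (insert v T) = lateCount S N (insert u T) := by
    intro v hv
    have hv : v ∉ T := by simpa using hv
    unfold lateCount
    refine Finset.card_bij' (fun π _ => π.trans (Equiv.swap u v))
      (fun π _ => π.trans (Equiv.swap u v)) ?_ ?_ ?_ ?_
    · intro π hπ
      simp only [Finset.mem_filter, Finset.mem_univ, true_and, Finset.forall_mem_insert,
        Equiv.symm_trans_apply, Equiv.symm_swap, Equiv.swap_apply_left] at hπ ⊢
      refine ⟨hπ.1, fun w hw => ?_⟩
      rw [Equiv.swap_apply_of_ne_of_ne (by rintro rfl; exact hu hw) (by rintro rfl; exact hv hw)]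
      exact hπ.2 w hw
    · intro π hπ
      simp only [Finset.mem_filter, Finset.mem_univ, true_and, Finset.forall_mem_insert,
        Equiv.symm_trans_apply, Equiv.symm_swap, Equiv.swap_apply_right] at hπ ⊢
      refine ⟨hπ.1, fun w hw => ?_⟩
      rw [Equiv.swap_apply_of_ne_of_ne (by rintro rfl; exact hu hw) (by rintro rfl; exact hv hw)]
      exact hπ.2 w hw
    · intro π _
      ext; simp
    · intro π _
      ext; simp
  have hcard : Tᶜ.card = S.card - T.card := by
    rw [Finset.card_compl, Fintype.card_coe]
  rw [← hcard, ← smul_eq_mul, ← Finset.sum_const, ← Finset.sum_congr rfl hsym]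
  unfold lateCount
  simp_rw [Finset.card_filter]
  rw [Finset.sum_comm, Finset.mul_sum]
  refine Finset.sum_le_sum fun π _ => ?_
  simp only [Finset.forall_mem_insert]
  by_cases h : ∀ v ∈ T, N ≤ (π.symm v : ℕ)
  · simp only [if_pos h, and_iff_left h, mul_one]
    rw [← Finset.card_filter]
    have hlate : (Finset.univ.filter fun v => N ≤ (π.symm v : ℕ)).card = S.card - N := by
      rw [← Finset.card_map π.symm.toEmbedding]
      have : Finset.map π.symm.toEmbedding (Finset.univ.filter fun v => N ≤ (π.symm v : ℕ))
          = Finset.univ.filter fun k : Fin S.card => ¬ (k : ℕ) < N := by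
        ext k
        simp [Finset.mem_map_equiv]
      rw [this, Finset.filter_not, Finset.card_sdiff_of_subset (Finset.filter_subset _ _)]
      simp [Fin.card_filter_val_lt, hN]
    rw [← hlate]
    have : Tᶜ.filter (fun v => N ≤ (π.symm v : ℕ))
        = (Finset.univ.filter fun v => N ≤ (π.symm v : ℕ)) \ T := by
      ext v; simp [and_comm]
    rw [this, Finset.card_sdiff_of_subset]
    intro v hv
    simpa using h v hv
  · simp only [h, and_false, if_false]
    simp

open Classical in
-- Sampling without replacement: being late only gets less likely once other elements are late, as
-- `(m - N - t) / (m - t) ≤ (m - N) / m`.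
theorem lateCount_le {W : Type*} (S : Finset W) (N : ℕ) (hN : N ≤ S.card) (y : ℝ≥0∞)
    (hy : ((S.card - N : ℕ) : ℝ≥0∞) ≤ y * S.card) (T : Finset {w : W // w ∈ S}) :
    (lateCount S N T : ℝ≥0∞)
      ≤ y ^ T.card * Fintype.card (Fin S.card ≃ {w : W // w ∈ S}) := by
  induction T using Finset.induction_on with
  | empty => simp [lateCount]
  | insert u T hu ih =>
    rw [Finset.card_insert_of_notMem hu, pow_succ, mul_comm _ y, mul_assoc]
    refine le_trans ?_ (mul_le_mul_right ih y)
    have hT : T.card < S.card := by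
      have := Finset.card_le_univ (insert u T)
      rw [Finset.card_insert_of_notMem hu, Fintype.card_coe] at this
      omega
    have h1 := lateCount_insert S N hN T u hu
    have h2 : S.card * lateCount S N (insert u T) ≤ (S.card - N) * lateCount S N T := by
      refine Nat.le_of_mul_le_mul_left (c := S.card - T.card) ?_ (by omega)
      calc (S.card - T.card) * (S.card * lateCount S N (insert u T))
          = S.card * ((S.card - T.card) * lateCount S N (insert u T)) := by ring
        _ ≤ S.card * ((S.card - N - T.card) * lateCount S N T) := Nat.mul_le_mul_left _ h1
        _ = (S.card * (S.card - N - T.card)) * lateCount S N T := by ring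
        _ ≤ ((S.card - T.card) * (S.card - N)) * lateCount S N T := by
            refine Nat.mul_le_mul_right _ ?_
            obtain ⟨a, ha⟩ := Nat.exists_eq_add_of_le hT.le
            rcases le_total T.card (S.card - N) with h | h
            · obtain ⟨b, hb⟩ := Nat.exists_eq_add_of_le h
              have : b ≤ a := by omega
              rw [hb, ha, Nat.add_sub_cancel_left, Nat.add_sub_cancel_left]
              nlinarith
            · rw [Nat.sub_eq_zero_of_le h]; simp
        _ = (S.card - T.card) * ((S.card - N) * lateCount S N T) := by ring
    have h3 : (S.card : ℝ≥0∞) ≠ 0 := by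
      have : 0 < S.card := by omega
      exact_mod_cast this.ne'
    rw [← ENNReal.mul_le_mul_iff_right h3 (ENNReal.natCast_ne_top _)]
    calc (S.card : ℝ≥0∞) * lateCount S N (insert u T)
        ≤ ((S.card - N : ℕ) : ℝ≥0∞) * lateCount S N T := by exact_mod_cast h2
      _ ≤ (y * S.card) * lateCount S N T := by gcongr
      _ = _ := by ring

theorem mem_take_ofFn {W : Type*} (S : Finset W) (N : ℕ) (π : Fin S.card ≃ {w : W // w ∈ S})
    (v : {w : W // w ∈ S}) (hv : v.1 ∉ (List.ofFn fun k => (π k).1).take N) :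
    N ≤ (π.symm v : ℕ) := by
  by_contra! h
  apply hv
  rw [List.mem_take_iff_getElem]
  refine ⟨(π.symm v : ℕ), ?_, ?_⟩
  · simp [h]
  · simp

open Classical in
-- Each vertex of `T` either is late, at price `y`, or picks a color of `F v`, at price `x`. Summing
-- over the late set `U` gives a binomial expansion of `(x + y) ^ T.card`.
theorem cliqueLaw_forall_le {Col W : Type*} [Fintype W] (Q F : W → Finset Col) (x y : ℝ≥0∞)
    (γ : ℝ) (S : Finset W) (hN : ⌈(S.card : ℝ) * γ⌉₊ ≤ S.card)
    (hQ : ∀ v ∈ S, ⌈(S.card : ℝ) * γ⌉₊ ≤ (Q v).card)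
    (hF : ∀ v ∈ S, ((F v).card : ℝ≥0∞) ≤ x * ((Q v).card + 1 - ⌈(S.card : ℝ) * γ⌉₊ : ℕ))
    (hy : ((S.card - ⌈(S.card : ℝ) * γ⌉₊ : ℕ) : ℝ≥0∞) ≤ y * S.card)
    (T : Finset W) (hT : T ⊆ S) :
    (cliqueLaw Q γ S).toOuterMeasure {f | ∀ v ∈ T, ∀ c, f v = some c → c ∈ F v}
      ≤ (x + y) ^ T.card := by
  set N := ⌈(S.card : ℝ) * γ⌉₊ with hNdef
  set T' : Finset {w : W // w ∈ S} := T.subtype (· ∈ S) with hT'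
  have hT'card : T'.card = T.card := by
    rw [hT', Finset.card_subtype, Finset.filter_true_of_mem hT]
  have hmemT' : ∀ v : {w : W // w ∈ S}, v ∈ T' ↔ v.1 ∈ T := by simp [hT']
  have hfix : ∀ π : Fin S.card ≃ {w : W // w ∈ S},
      (pickInOrder Q ((List.ofFn fun k => (π k).1).take N) fun _ => none).toOuterMeasure
        {f | ∀ v ∈ T, ∀ c, f v = some c → c ∈ F v}
      ≤ ∑ U ∈ T'.powerset, x ^ (T' \ U).card *
          if ∀ v ∈ U, N ≤ (π.symm v : ℕ) then 1 else 0 := by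
    intro π
    set l := (List.ofFn fun k => (π k).1).take N with hl
    have hlS : ∀ v ∈ l, v ∈ S := by
      intro v hv
      have := List.mem_of_mem_take hv
      rw [List.mem_ofFn] at this
      obtain ⟨k, hk⟩ := this
      exact hk ▸ (π k).2
    have hnd : l.Nodup := by
      refine List.Nodup.sublist (List.take_sublist _ _) ?_
      rw [List.nodup_ofFn]
      exact Subtype.val_injective.comp π.injective
    have h1 := pickInOrder_forall_le Q F x N l hnd (fun v hv => hQ v (hlS v hv))
      (fun v hv => hF v (hlS v hv)) (fun _ => none) ∅ (by simp)
      (by simp [hl]) (T.filter (· ∈ l)) (by simp)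
    refine le_trans (MeasureTheory.measure_mono ?_) (h1.trans ?_)
    · intro f hf v hv
      exact hf v (Finset.mem_filter.1 hv).1
    -- For a fixed `π`, the bound is the single term of the actual late set; the other terms are
    -- nonnegative.
    · set U := T'.filter (fun v => v.1 ∉ l) with hU
      refine le_trans (le_of_eq ?_) (Finset.single_le_sum (f := fun U => x ^ (T' \ U).card *
          if ∀ v ∈ U, N ≤ (π.symm v : ℕ) then 1 else 0) (fun _ _ => zero_le)
          (Finset.mem_powerset.2 (Finset.filter_subset (fun v => v.1 ∉ l) T')))
      have : (∀ v ∈ T'.filter (fun v => v.1 ∉ l), N ≤ (π.symm v : ℕ)) := by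
        intro v hv
        exact mem_take_ofFn S N π v (Finset.mem_filter.1 hv).2
      simp only [if_pos this, mul_one]
      congr 1
      rw [← Finset.filter_not, ← Finset.card_map (Function.Embedding.subtype (· ∈ S))]
      congr 1
      ext v
      simp only [Finset.mem_filter, Finset.mem_map, hmemT', Function.Embedding.coe_subtype,
        not_not, Subtype.exists, exists_and_right, exists_eq_right]
      exact ⟨fun h => ⟨⟨hT h.1, h.1⟩, h.2⟩, fun h => ⟨h.1.2, h.2⟩⟩
  rw [cliqueLaw, PMF.toOuterMeasure_bind_apply, tsum_fintype]
  have hcard0 : (Fintype.card (Fin S.card ≃ {w : W // w ∈ S}) : ℝ≥0∞) ≠ 0 := by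
    exact_mod_cast Fintype.card_ne_zero
  calc _ ≤ ∑ π : Fin S.card ≃ {w : W // w ∈ S},
        (Fintype.card (Fin S.card ≃ {w : W // w ∈ S}) : ℝ≥0∞)⁻¹ *
        ∑ U ∈ T'.powerset, x ^ (T' \ U).card *
          (if ∀ v ∈ U, N ≤ (π.symm v : ℕ) then 1 else 0) := by
        refine Finset.sum_le_sum fun π _ => ?_
        rw [PMF.uniformOfFintype_apply]
        exact mul_le_mul_right (hfix π) _
    _ = (Fintype.card (Fin S.card ≃ {w : W // w ∈ S}) : ℝ≥0∞)⁻¹ *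
          ∑ U ∈ T'.powerset, x ^ (T' \ U).card * (lateCount S N U : ℝ≥0∞) := by
        rw [← Finset.mul_sum, Finset.sum_comm]
        congr 1
        refine Finset.sum_congr rfl fun U _ => ?_
        rw [← Finset.mul_sum, lateCount, Finset.card_filter]
        push_cast
        rfl
    _ ≤ (Fintype.card (Fin S.card ≃ {w : W // w ∈ S}) : ℝ≥0∞)⁻¹ *
          ∑ U ∈ T'.powerset, x ^ (T' \ U).card *
            (y ^ U.card * Fintype.card (Fin S.card ≃ {w : W // w ∈ S})) := by
        gcongr with U _
        exact lateCount_le S N hN y hy U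
    _ = (x + y) ^ T.card := by
        simp_rw [← mul_assoc]
        rw [← Finset.sum_mul, mul_comm, mul_assoc,
          ENNReal.mul_inv_cancel hcard0 (ENNReal.natCast_ne_top _), mul_one, ← hT'card, add_comm,
          ← Finset.prod_const, Finset.prod_add]
        refine Finset.sum_congr rfl fun U _ => ?_
        simp [mul_comm]

theorem exists_card_le_of_mem_support_cliqueLaw {Col W : Type*} [Fintype W] (Q : W → Finset Col) (γ : ℝ)
    (S : Finset W) (f : W → Option Col) (hf : f ∈ (cliqueLaw Q γ S).support) :
    ∃ B ⊆ S, B.card ≤ ⌈(S.card : ℝ) * γ⌉₊ ∧ ∀ v, f v ≠ none → v ∈ B := by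
  classical
  rw [cliqueLaw, PMF.mem_support_bind_iff] at hf
  obtain ⟨π, -, hf⟩ := hf
  refine ⟨((List.ofFn fun k => (π k).1).take ⌈(S.card : ℝ) * γ⌉₊).toFinset, ?_, ?_, ?_⟩
  · intro v hv
    have := List.mem_of_mem_take (List.mem_toFinset.1 hv)
    rw [List.mem_ofFn] at this
    obtain ⟨k, hk⟩ := this
    exact hk ▸ (π k).2
  · exact (List.toFinset_card_le _).trans (by simp)
  · intro v hv
    by_contra h
    exact hv (pickInOrder_support_of_notMem Q _ _ f (by convert hf) v
      (fun h' => h (List.mem_toFinset.2 h')))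

/-! ### An upper tail bound -/

open Classical in
-- Union bound over the `s`-element subsets of `B`; product bounds replace independence.
theorem toOuterMeasure_le_card_filter_le {α W : Type*} (p : PMF α) (B : Finset W)
    (bad : α → W → Prop) (z : ℝ≥0∞)
    (h : ∀ T ⊆ B, p.toOuterMeasure {a | ∀ v ∈ T, bad a v} ≤ z ^ T.card) (s : ℕ) :
    p.toOuterMeasure {a | s ≤ (B.filter (bad a)).card} ≤ B.card.choose s * z ^ s := by
  calc p.toOuterMeasure {a | s ≤ (B.filter (bad a)).card}
      ≤ p.toOuterMeasure (⋃ T ∈ B.powersetCard s, {a | ∀ v ∈ T, bad a v}) := by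
        refine MeasureTheory.measure_mono fun a ha => ?_
        obtain ⟨T, hT, hTs⟩ := Finset.exists_subset_card_eq ha
        simp only [Set.mem_iUnion]
        exact ⟨T, Finset.mem_powersetCard.2 ⟨hT.trans (Finset.filter_subset _ _), hTs⟩,
          fun v hv => (Finset.mem_filter.1 (hT hv)).2⟩
    _ ≤ ∑ T ∈ B.powersetCard s, p.toOuterMeasure {a | ∀ v ∈ T, bad a v} :=
        MeasureTheory.measure_biUnion_finset_le _ _
    _ ≤ ∑ T ∈ B.powersetCard s, z ^ s := by
        refine Finset.sum_le_sum fun T hT => ?_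
        rw [Finset.mem_powersetCard] at hT
        exact hT.2 ▸ h T hT.1
    _ = B.card.choose s * z ^ s := by simp

theorem exp_one_div_four_le : Real.exp 1 / 4 ≤ Real.exp (-(1 / 3)) := by
  have h1 : Real.exp (4 / 3) ≤ 4 := by
    refine le_of_pow_le_pow_left₀ (n := 3) (by norm_num) (by norm_num) ?_
    rw [← Real.exp_nat_mul]
    -- After cubing, the claim is `e ^ 4 ≤ 64`.
    have : ((3 : ℕ) : ℝ) * (4 / 3) = ((4 : ℕ) : ℝ) * 1 := by norm_num
    rw [this, Real.exp_nat_mul]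
    calc Real.exp 1 ^ 4 ≤ 2.8 ^ 4 := by
          gcongr
          exact Real.exp_one_lt_d9.le.trans (by norm_num)
      _ ≤ 4 ^ 3 := by norm_num
  have h2 : Real.exp 1 = Real.exp (4 / 3) * Real.exp (-(1 / 3)) := by
    rw [← Real.exp_add]; norm_num
  rw [h2, div_le_iff₀ (by norm_num), mul_comm]
  gcongr

/-- From `b.choose s ≤ b ^ s / s!` and `s ^ s / s! ≤ e ^ s` the left side is at most `(e / 4) ^ s`.
-/
theorem choose_mul_pow_le_exp (b s : ℕ) (z : ℝ) (hz : 0 ≤ z) (h : b * z ≤ s / 4) :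
    b.choose s * z ^ s ≤ Real.exp (-(s / 3)) := by
  calc (b.choose s : ℝ) * z ^ s ≤ (b : ℝ) ^ s / s.factorial * z ^ s := by
        gcongr
        exact Nat.choose_le_pow_div s b
    _ = (b * z) ^ s / s.factorial := by rw [mul_pow]; ring
    _ ≤ ((s : ℝ) / 4) ^ s / s.factorial := by gcongr
    _ = (1 / 4) ^ s * ((s : ℝ) ^ s / s.factorial) := by rw [div_pow, div_pow]; ring
    _ ≤ (1 / 4) ^ s * Real.exp s := by
        gcongr
        exact Real.pow_div_factorial_le_exp _ (by positivity) _
    _ = (Real.exp 1 / 4) ^ s := by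
        rw [div_pow, div_pow, one_pow, ← Real.exp_nat_mul, mul_one]; ring
    _ ≤ Real.exp (-(1 / 3)) ^ s := by
        gcongr
        exact exp_one_div_four_le
    _ = Real.exp (-(s / 3)) := by
        rw [← Real.exp_nat_mul]; congr 1; ring

/-! ### Palettes -/

/-- Only colored neighbors remove colors. With a list of at least `Δ + 1` colors and at most `Δ`
neighbors, the palette exceeds the number of uncolored neighbors, which include all but `antiDegree
χ v` vertices of the residual clique. -/
theorem card_resClique_lt {V Col : Type*} [Fintype V] {G : SimpleGraph V} {ε : ℝ}
    (pal : V → Finset Col) (χ : V → Option Col) (v : DenseVertex G ε)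
    (hpal : maxDeg G + 1 ≤ (pal v.1).card) :
    (resClique χ (cliqueOf v)).card + 1 ≤ (resPalette G pal χ v.1).card + antiDegree χ v := by
  classical
  set nb : Finset V := Finset.univ.filter fun w => G.Adj v.1 w with hnb
  have hdeg : nb.card ≤ maxDeg G := by
    rw [maxDeg]
    refine le_trans (le_of_eq ?_) (G.degree_le_maxDegree v.1)
    rw [← SimpleGraph.card_neighborFinset_eq_degree]
    congr 1
    ext w
    simp [hnb]
  have hsplit : (nb.filter fun w => χ w = none).card + (nb.filter fun w => ¬ χ w = none).card
      = nb.card := Finset.card_filter_add_card_filter_not _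
  have h1 : (pal v.1).card
      ≤ (resPalette G pal χ v.1).card + (nb.filter fun w => ¬ χ w = none).card * 1 := by
    refine le_trans (Finset.card_le_card (t := resPalette G pal χ v.1 ∪
      (nb.filter fun w => ¬ χ w = none).biUnion fun w => (χ w).toFinset) ?_)
      ((Finset.card_union_le _ _).trans (Nat.add_le_add_left
        (Finset.card_biUnion_le_card_mul _ _ _ fun w _ => ?_) _))
    · intro c hc
      by_cases h : ∀ w, G.Adj v.1 w → χ w ≠ some c
      · exact Finset.mem_union_left _ (Finset.mem_filter.2 ⟨hc, h⟩)
      · push Not at h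
        obtain ⟨w, hw, hwc⟩ := h
        exact Finset.mem_union_right _ (Finset.mem_biUnion.2 ⟨w, by simp [hnb, hw, hwc],
          by simp [hwc]⟩)
    · cases χ w <;> simp
  have h2 : ((resClique χ (cliqueOf v)).filter fun w => G.Adj v.1 w.1).card
      ≤ (nb.filter fun w => χ w = none).card := by
    rw [← Finset.card_map (Function.Embedding.subtype _)]
    refine Finset.card_le_card fun w hw => ?_
    rw [Finset.mem_map] at hw
    obtain ⟨u, hu, rfl⟩ := hw
    simp only [resClique, Finset.mem_filter, Finset.mem_univ, true_and] at hu
    simp [hnb, hu.1.2, hu.2]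
  have h3 : ((resClique χ (cliqueOf v)).filter fun w => G.Adj v.1 w.1).card
      + ((resClique χ (cliqueOf v)).filter fun w => ¬ G.Adj v.1 w.1).card
      = (resClique χ (cliqueOf v)).card := Finset.card_filter_add_card_filter_not _
  have h4 : antiDegree χ v
      = ((resClique χ (cliqueOf v)).filter fun w => ¬ G.Adj v.1 w.1).card := by
    unfold antiDegree; congr!
  omega

theorem exists_card_le_of_mem_support_tentativeLaw {V Col : Type*} [Fintype V]
    {G : SimpleGraph V} {ε : ℝ} {pal : V → Finset Col} {χ : V → Option Col} {γ : ℝ}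
    {A : DenseVertex G ε → Option Col} (hA : A ∈ (tentativeLaw G ε pal χ γ).support)
    (C : AlmostClique G ε) :
    ∃ B ⊆ resClique χ C, B.card ≤ ⌈((resClique χ C).card : ℝ) * γ⌉₊ ∧
      ∀ v, cliqueOf v = C → A v ≠ none → v ∈ B := by
  rw [tentativeLaw, PMF.mem_support_map_iff] at hA
  obtain ⟨f, hf, rfl⟩ := hA
  classical
  obtain ⟨B, hBS, hB, h⟩ := exists_card_le_of_mem_support_cliqueLaw _ _ _ _
    (mem_support_of_mem_support_productPMF hf C)
  refine ⟨B, hBS, hB, ?_⟩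
  rintro v rfl hv
  exact h v hv

/-! ### The coloring after conflicts are resolved -/

section Commit

variable {V Col : Type*} [Fintype V] {G : SimpleGraph V} {ε : ℝ} (ID : V → ℕ)
  (leader : AlmostClique G ε → DenseVertex G ε) (χ : V → Option Col)
  (A : DenseVertex G ε → Option Col)

theorem commit_eq_of_ne_none {v : V} (h : χ v ≠ none) : commit ID leader χ A v = χ v := by
  rw [commit, if_pos h]

theorem eq_none_of_commit_eq_none {v : V} (h : commit ID leader χ A v = none) : χ v = none := by
  by_contra h'
  rw [commit_eq_of_ne_none ID leader χ A h'] at h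
  exact h' h

theorem exists_eq_of_commit_eq_some {v : V} {c : Col} (h : commit ID leader χ A v = some c)
    (hv : χ v = none) : ∃ hd : IsDense G ε v, A ⟨v, hd⟩ = some c := by
  unfold commit at h
  split_ifs at h with h1 h2 h3
  · exact absurd hv h1
  · exact ⟨h2, h⟩

theorem exists_conflict_of_commit_eq_none {v : DenseVertex G ε} {c : Col}
    (h : commit ID leader χ A v.1 = none) (hA : A v = some c) :
    ∃ w : DenseVertex G ε, G.Adj v.1 w.1 ∧ A w = some c ∧
        ID (leader (cliqueOf w)).1 < ID (leader (cliqueOf v)).1 := by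
  have hχ := eq_none_of_commit_eq_none ID leader χ A h
  unfold commit at h
  rw [if_neg (not_not.2 hχ), dif_pos v.2] at h
  split_ifs at h with h3
  · obtain ⟨w, h1, h2, h4⟩ := h3
    exact ⟨w, h1, h2.trans hA, h4⟩
  · simp [hA] at h

/-- A color lost in the step was picked by an uncolored external neighbor or by one of the `⌈M *
γ⌉₊` picking vertices of the own clique. This holds for every outcome in the support. -/
theorem card_resPalette_le {pal : V → Finset Col} {γ : ℝ}
    (hA : A ∈ (tentativeLaw G ε pal χ γ).support) (v : DenseVertex G ε) :
    (resPalette G pal χ v.1).card ≤ (resPalette G pal (commit ID leader χ A) v.1).card +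
      extDegree χ v + ⌈((resClique χ (cliqueOf v)).card : ℝ) * γ⌉₊ := by
  classical
  obtain ⟨B, -, hB, hmem⟩ := exists_card_le_of_mem_support_tentativeLaw hA (cliqueOf v)
  set X : Finset (DenseVertex G ε) := Finset.univ.filter fun w =>
    χ w.1 = none ∧ G.Adj v.1 w.1 ∧ cliqueOf w ≠ cliqueOf v with hX
  have hXcard : X.card = extDegree χ v := by
    unfold extDegree; congr!
  have h1 : resPalette G pal χ v.1 ⊆ resPalette G pal (commit ID leader χ A) v.1 ∪
      (X ∪ B).biUnion fun w => (A w).toFinset := by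
    intro c hc
    rw [resPalette, Finset.mem_filter] at hc
    by_cases h : ∀ w, G.Adj v.1 w → commit ID leader χ A w ≠ some c
    · exact Finset.mem_union_left _ (Finset.mem_filter.2 ⟨hc.1, h⟩)
    · push Not at h
      obtain ⟨w, hw, hwc⟩ := h
      have hχ : χ w = none := by
        by_contra h'
        rw [commit_eq_of_ne_none ID leader χ A h'] at hwc
        exact hc.2 w hw hwc
      obtain ⟨hd, hAw⟩ := exists_eq_of_commit_eq_some ID leader χ A hwc hχ
      refine Finset.mem_union_right _ (Finset.mem_biUnion.2 ⟨⟨w, hd⟩, ?_, by simp [hAw]⟩)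
      by_cases hcl : cliqueOf (⟨w, hd⟩ : DenseVertex G ε) = cliqueOf v
      · exact Finset.mem_union_right _ (hmem _ hcl (by simp [hAw]))
      · exact Finset.mem_union_left _ (Finset.mem_filter.2 ⟨Finset.mem_univ _, hχ, hw, hcl⟩)
  have h2 : ((X ∪ B).biUnion fun w => (A w).toFinset).card ≤ (X ∪ B).card * 1 :=
    Finset.card_biUnion_le_card_mul _ _ _ fun w _ => by cases A w <;> simp
  have h3 := (Finset.card_le_card h1).trans (Finset.card_union_le _ _)
  have h4 := Finset.card_union_le X B
  omega

end Commit

/-! ### Vertices that remain uncolored -/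

/-- Rank the cliques by leader ID. The dangerous colors `F f v` depend only on cliques of strictly
smaller rank, so they are fixed while the clique of `v` is sampled, and they number at most
`extDegree χ v`. -/
theorem tentativeLaw_forall_commit_eq_none_le {V Col : Type*} [Fintype V] {G : SimpleGraph V}
    {ε : ℝ} {pal : V → Finset Col} {ID : V → ℕ} (hID : Function.Injective ID)
    {leader : AlmostClique G ε → DenseVertex G ε} (hleader : ∀ C, cliqueOf (leader C) = C)
    {χ : V → Option Col} {γ : ℝ} (x y : ℝ≥0∞)
    (hN : ∀ C : AlmostClique G ε,
      ⌈((resClique χ C).card : ℝ) * γ⌉₊ ≤ (resClique χ C).card)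
    (hy : ∀ C : AlmostClique G ε,
      (((resClique χ C).card - ⌈((resClique χ C).card : ℝ) * γ⌉₊ : ℕ) : ℝ≥0∞)
        ≤ y * (resClique χ C).card)
    (hQ : ∀ v : DenseVertex G ε, χ v.1 = none →
      ⌈((resClique χ (cliqueOf v)).card : ℝ) * γ⌉₊ ≤ (resPalette G pal χ v.1).card)
    (hx : ∀ v : DenseVertex G ε, χ v.1 = none →
      (extDegree χ v : ℝ≥0∞) ≤ x * ((resPalette G pal χ v.1).card + 1 -
        ⌈((resClique χ (cliqueOf v)).card : ℝ) * γ⌉₊ : ℕ))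
    (T : Finset (DenseVertex G ε)) (hT : ∀ v ∈ T, χ v.1 = none) :
    (tentativeLaw G ε pal χ γ).toOuterMeasure
      {A | ∀ v ∈ T, commit ID leader χ A v.1 = none} ≤ (x + y) ^ T.card := by
  classical
  set r : AlmostClique G ε → ℕ := fun C => ID (leader C).1
  have hr : Function.Injective r := by
    intro C C' h
    rw [← hleader C, ← hleader C', Subtype.ext (hID h)]
  let X : DenseVertex G ε → Finset (DenseVertex G ε) := fun v => Finset.univ.filter fun w =>
    χ w.1 = none ∧ G.Adj v.1 w.1 ∧ r (cliqueOf w) < r (cliqueOf v)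
  let F : (AlmostClique G ε → DenseVertex G ε → Option Col) → DenseVertex G ε → Finset Col :=
    fun f v => (X v).biUnion fun w => (f (cliqueOf w) w).toFinset
  have hFcard : ∀ f v, (F f v).card ≤ extDegree χ v := by
    intro f v
    calc (F f v).card ≤ (X v).card * 1 :=
          Finset.card_biUnion_le_card_mul _ _ _ fun w _ => by cases f (cliqueOf w) w <;> simp
      _ ≤ extDegree χ v := by
          rw [mul_one, extDegree]
          refine Finset.card_le_card fun w hw => ?_
          simp only [X, Finset.mem_filter, Finset.mem_univ, true_and] at hw ⊢
          exact ⟨hw.1, hw.2.1, fun h => by rw [h] at hw; exact lt_irrefl _ hw.2.2⟩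
  have hFcongr : ∀ f g v, (∀ C, r C < r (cliqueOf v) → f C = g C) → F f v = F g v := by
    intro f g v h
    refine Finset.biUnion_congr rfl fun w hw => ?_
    simp only [X, Finset.mem_filter, Finset.mem_univ, true_and] at hw
    rw [h _ hw.2.2]
  let E : AlmostClique G ε → Set (AlmostClique G ε → DenseVertex G ε → Option Col) :=
    fun C => {f | ∀ v ∈ T.filter (fun v => cliqueOf v = C), ∀ c, f C v = some c → c ∈ F f v}
  rw [tentativeLaw, PMF.toOuterMeasure_map_apply]
  refine le_trans (PMF.toOuterMeasure_mono (t := {f | ∀ C ∈ Finset.univ, f ∈ E C}) _ ?_)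
    ((productPMF_forall_mem_le _ r hr E
      (fun C => (x + y) ^ (T.filter fun v => cliqueOf v = C).card) ?_ ?_ _).trans_eq ?_)
  · rintro f ⟨hf, hsupp⟩ C - v hv c hc
    rw [Finset.mem_filter] at hv
    obtain ⟨hvT, rfl⟩ := hv
    obtain ⟨w, hw, hwc, hlt⟩ := exists_conflict_of_commit_eq_none ID leader χ _ (hf v hvT) hc
    -- The support is needed here: `w` has a tentative color, hence was uncolored before and is
    -- counted in `X v`.
    refine Finset.mem_biUnion.2 ⟨w, ?_, by simp [hwc]⟩
    obtain ⟨B, hBS, -, hmem⟩ := exists_card_le_of_mem_support_cliqueLaw _ _ _ _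
      (mem_support_of_mem_support_productPMF hsupp (cliqueOf w))
    have hwS := hBS (hmem w (by simp only [hwc]; simp))
    rw [resClique, Finset.mem_filter] at hwS
    exact Finset.mem_filter.2 ⟨Finset.mem_univ _, hwS.2.2, hw, hlt⟩
  · intro C f g hfg hf v hv c hc
    have hvC := (Finset.mem_filter.1 hv).2
    rw [← hFcongr f g v fun C' hC' => hfg C' (by rw [hvC] at hC'; exact hC'.le)]
    exact hf v hv c (by rw [hfg C le_rfl]; exact hc)
  · intro C f
    refine le_trans (MeasureTheory.measure_mono ?_) (cliqueLaw_forall_le _ (F f) x y γ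
      (resClique χ C) (hN C) ?_ ?_ (hy C) (T.filter fun v => cliqueOf v = C) ?_)
    · intro b hb v hv c hc
      have := hb v hv c (by rw [Function.update_self]; exact hc)
      -- Resampling clique `C` leaves the dangerous colors of its own vertices unchanged.
      rwa [hFcongr _ f v] at this
      intro C' hC'
      rw [Function.update_of_ne]
      rintro rfl
      rw [(Finset.mem_filter.1 hv).2] at hC'
      exact lt_irrefl _ hC'
    · intro v hv
      rw [resClique, Finset.mem_filter] at hv
      obtain ⟨-, rfl, hv⟩ := hv
      exact hQ v hv
    · intro v hv
      rw [resClique, Finset.mem_filter] at hv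
      obtain ⟨-, rfl, hv⟩ := hv
      refine le_trans ?_ (hx v hv)
      exact_mod_cast hFcard f v
    · intro v hv
      rw [Finset.mem_filter] at hv
      exact Finset.mem_filter.2 ⟨Finset.mem_univ _, hv.2, hT v hv.1⟩
  · rw [Finset.prod_pow_eq_pow_sum, Finset.card_eq_sum_card_fiberwise (s := T)
      (t := Finset.univ) (f := fun v => cliqueOf v) fun _ _ => Finset.mem_coe.2 (Finset.mem_univ _)]

/-! ### Numerical estimates -/

theorem two_mul_sub_sq_mul_le {Z D s M Q a : ℝ} (hZ : 0 < Z) (hs : 0 < s) (hs' : s ≤ 1 / 10)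
    (hD : D = s ^ 2 * Z) (hQ : Z ≤ Q) (ha : a ≤ D) (hM : M + 1 ≤ Q + a) :
    (2 * s - 2 * s ^ 2) * Z ≤ Q - D - M * (1 - 2 * s) := by
  have h3 : 0 ≤ s * D := by rw [hD]; positivity
  -- For small `M` use `Q ≥ Z`; for large `M` use `Q ≥ M + 1 - D`, where the unprocessed part `2 * s
  -- * M` supplies the slack.
  rcases le_total M (Z + D) with h | h
  · nlinarith [mul_le_mul_of_nonneg_right h (by linarith : 0 ≤ 1 - 2 * s)]
  · nlinarith [mul_le_mul_of_nonneg_right h hs.le]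

/-- The tail bound for a real threshold `t`, rounded up to `⌈t⌉₊`. It is applied with at most `D`
vertices, `z = 3 * s` and `t = 12 * D * s`, whence the constant 12. -/
theorem toOuterMeasure_lt_card_filter_le_exp {α W : Type*} (p : PMF α) (B : Finset W)
    (bad : α → W → Prop) (z t : ℝ) (hz : 0 ≤ z)
    (h : ∀ T ⊆ B, p.toOuterMeasure {a | ∀ v ∈ T, bad a v} ≤ ENNReal.ofReal z ^ T.card)
    (ht : 4 * (B.card * z) ≤ t) (N : α → ℕ)
    (hN : ∀ a, ∃ R : Finset W, R ⊆ B ∧ (∀ v ∈ R, bad a v) ∧ N a = R.card) :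
    p.toOuterMeasure {a | t < N a} ≤ ENNReal.ofReal (Real.exp (-(t / 3))) := by
  classical
  refine (MeasureTheory.measure_mono ?_).trans
    ((toOuterMeasure_le_card_filter_le p B bad _ h ⌈t⌉₊).trans ?_)
  · intro a ha
    obtain ⟨R, hRB, hR, hNR⟩ := hN a
    have h1 : ⌈t⌉₊ ≤ N a := Nat.ceil_le.2 (le_of_lt ha)
    exact h1.trans (hNR.le.trans (Finset.card_le_card fun v hv =>
      Finset.mem_filter.2 ⟨hRB hv, hR v hv⟩))
  · rw [← ENNReal.ofReal_natCast, ← ENNReal.ofReal_pow hz, ← ENNReal.ofReal_mul (by positivity)]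
    refine ENNReal.ofReal_le_ofReal ((choose_mul_pow_le_exp _ _ z hz ?_).trans ?_)
    · linarith [Nat.le_ceil t]
    · gcongr
      exact Nat.le_ceil t

theorem mul_exp_le_rpow {n K K' t : ℝ} (hn : 2 ≤ n) (hK : 100 ≤ K) (hK' : K' + 2 ≤ K)
    (ht : K * Real.log n ≤ t) : n * (2 * Real.exp (-(4 * t))) ≤ n ^ (-K') := by
  have hn0 : 0 < n := by linarith
  have hlog : 0 ≤ Real.log n := Real.log_nonneg (by linarith)
  rw [Real.rpow_def_of_pos hn0]
  calc n * (2 * Real.exp (-(4 * t))) ≤ n * (n * Real.exp (-(4 * t))) := by gcongr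
    _ = Real.exp (Real.log n + (Real.log n + -(4 * t))) := by
        rw [Real.exp_add, Real.exp_add, Real.exp_log hn0]
    _ ≤ Real.exp (Real.log n * -K') := by
        gcongr
        nlinarith [mul_le_mul_of_nonneg_right hK' hlog, mul_le_mul_of_nonneg_right hK hlog]

theorem one_le_of_log_le {n K D δ : ℝ} (hn : 2 ≤ n) (hK : 100 ≤ K) (hδ : δ ≤ 1 / K) (hD : 0 < D)
    (h : K * Real.log n ≤ D * δ) : 1 ≤ D := by
  have h1 : 0.69 ≤ Real.log n :=
    (by linarith [Real.log_two_gt_d9] : (0.69 : ℝ) ≤ Real.log 2).trans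
      (Real.log_le_log (by norm_num) hn)
  have h2 : δ ≤ 1 / 100 := hδ.trans (one_div_le_one_div_of_le (by norm_num) hK)
  nlinarith [mul_le_mul hK h1 (by norm_num) (by linarith)]

/-! ### The regularity conditions put to use -/

section Main

variable {V Col : Type*} [Fintype V] {G : SimpleGraph V} {ε : ℝ} {pal : V → Finset Col}
  {ID : V → ℕ} {leader : AlmostClique G ε → DenseVertex G ε} {χ : V → Option Col} {D Z s : ℝ}

theorem slack_le (hZ : 0 < Z) (hs : 0 < s) (hs' : s ≤ 1 / 10) (hD : D = s ^ 2 * Z)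
    (hpal : ∀ v, maxDeg G + 1 ≤ (pal v).card) {v : DenseVertex G ε}
    (ha : (antiDegree χ v : ℝ) ≤ D) (hQ : Z ≤ ((resPalette G pal χ v.1).card : ℝ)) :
    (2 * s - 2 * s ^ 2) * Z ≤ (resPalette G pal χ v.1).card - D
      - (resClique χ (cliqueOf v)).card * (1 - 2 * s) := by
  refine two_mul_sub_sq_mul_le hZ hs hs' hD hQ ha ?_
  exact_mod_cast card_resClique_lt pal χ v (hpal v.1)

theorem tentativeLaw_forall_commit_eq_none_le_pow (hID : Function.Injective ID)
    (hleader : ∀ C, cliqueOf (leader C) = C)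
    (hZ : 0 < Z) (hs : 0 < s) (hs' : s ≤ 1 / 10) (hD : D = s ^ 2 * Z)
    (hpal : ∀ v, maxDeg G + 1 ≤ (pal v).card)
    (hreg : ∀ v : DenseVertex G ε, χ v.1 = none → (antiDegree χ v : ℝ) ≤ D ∧
      (extDegree χ v : ℝ) ≤ D ∧ Z ≤ ((resPalette G pal χ v.1).card : ℝ))
    (T : Finset (DenseVertex G ε)) (hT : ∀ v ∈ T, χ v.1 = none) :
    (tentativeLaw G ε pal χ (1 - 2 * s)).toOuterMeasure
      {A | ∀ v ∈ T, commit ID leader χ A v.1 = none} ≤ ENNReal.ofReal (3 * s) ^ T.card := by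
  have hxy : ENNReal.ofReal (3 * s) = ENNReal.ofReal s + ENNReal.ofReal (2 * s) := by
    rw [← ENNReal.ofReal_add hs.le (by positivity)]; congr 1; ring
  rw [hxy]
  have hγ : 0 ≤ 1 - 2 * s := by linarith
  have hslack : ∀ v : DenseVertex G ε, χ v.1 = none → s * Z ≤ (resPalette G pal χ v.1).card
      - (resClique χ (cliqueOf v)).card * (1 - 2 * s) := by
    intro v hv
    obtain ⟨h1, -, h3⟩ := hreg v hv
    have h4 := slack_le hZ hs hs' hD hpal h1 h3
    have h5 : 0 ≤ D := by rw [hD]; positivity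
    -- Half of the slack suffices for the conflict probability.
    have h6 : s * Z ≤ (2 * s - 2 * s ^ 2) * Z := by
      gcongr
      nlinarith
    linarith
  have hNle : ∀ v : DenseVertex G ε, χ v.1 = none →
      ⌈((resClique χ (cliqueOf v)).card : ℝ) * (1 - 2 * s)⌉₊
        ≤ (resPalette G pal χ v.1).card := by
    intro v hv
    refine Nat.ceil_le.2 ?_
    have := hslack v hv
    have : 0 < s * Z := by positivity
    linarith
  refine tentativeLaw_forall_commit_eq_none_le hID hleader _ _ ?_ ?_ hNle ?_ T hT
  · intro C
    refine Nat.ceil_le.2 (mul_le_of_le_one_right (by positivity) (by linarith))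
  · intro C
    rw [← ENNReal.ofReal_natCast, ← ENNReal.ofReal_natCast, ← ENNReal.ofReal_mul (by positivity)]
    refine ENNReal.ofReal_le_ofReal ?_
    rw [Nat.cast_sub (Nat.ceil_le.2 (mul_le_of_le_one_right (by positivity) (by linarith)))]
    linarith [Nat.le_ceil (((resClique χ C).card : ℝ) * (1 - 2 * s))]
  · intro v hv
    rw [← ENNReal.ofReal_natCast, ← ENNReal.ofReal_natCast, ← ENNReal.ofReal_mul hs.le]
    refine ENNReal.ofReal_le_ofReal ?_
    rw [Nat.cast_sub ((hNle v hv).trans (Nat.le_succ _))]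
    have h1 := Nat.ceil_lt_add_one
      (mul_nonneg (Nat.cast_nonneg (α := ℝ) (resClique χ (cliqueOf v)).card) hγ)
    have h2 := hslack v hv
    refine (hreg v hv).2.1.trans ?_
    -- Here `D = s * (s * Z)`, and the `+ 1` in the number of available colors absorbs the rounding
    -- of `⌈M * γ⌉₊`.
    rw [hD, sq, mul_assoc]
    refine mul_le_mul_of_nonneg_left ?_ hs.le
    push_cast
    linarith

theorem le_card_resPalette_commit (hZ : 0 < Z) (hs : 0 < s) (hs' : s ≤ 1 / 10)
    (hD : D = s ^ 2 * Z) (hD1 : 1 ≤ D) (hpal : ∀ v, maxDeg G + 1 ≤ (pal v).card)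
    {v : DenseVertex G ε} (ha : (antiDegree χ v : ℝ) ≤ D) (he : (extDegree χ v : ℝ) ≤ D)
    (hQ : Z ≤ ((resPalette G pal χ v.1).card : ℝ)) {A : DenseVertex G ε → Option Col}
    (hA : A ∈ (tentativeLaw G ε pal χ (1 - 2 * s)).support) :
    s * Z ≤ ((resPalette G pal (commit ID leader χ A) v.1).card : ℝ) := by
  have h1 := slack_le hZ hs hs' hD hpal ha hQ
  have h2 : ((resPalette G pal χ v.1).card : ℝ) ≤ _ :=
    Nat.cast_le.2 (card_resPalette_le ID leader χ A hA v)
  push_cast at h2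
  have h3 := Nat.ceil_lt_add_one
    (mul_nonneg (Nat.cast_nonneg (α := ℝ) (resClique χ (cliqueOf v)).card)
      (by linarith : 0 ≤ 1 - 2 * s))
  -- Rounding up costs less than one color, which is at most a tenth of `s * Z`.
  have h4 : 10 ≤ s * Z := by
    have : 1 ≤ s * (s * Z) := by rw [← mul_assoc, ← sq, ← hD]; exact hD1
    nlinarith [mul_le_mul_of_nonneg_right hs' (by positivity : 0 ≤ s * Z)]
  have h5 : s * (s * Z) ≤ 1 / 10 * (s * Z) := by gcongr
  have h6 : (2 * s - 2 * s ^ 2) * Z = 2 * (s * Z) - 2 * (s * (s * Z)) := by ring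
  linarith

/-- The step never uncolors a vertex, so the new degrees count the vertices of fixed old sets, of
size at most `D`, that stay uncolored. The palette bound holds on the whole support and costs no
probability. -/
theorem toOuterMeasure_failure_le (hID : Function.Injective ID)
    (hleader : ∀ C, cliqueOf (leader C) = C)
    (hZ : 0 < Z) (hs : 0 < s) (hs' : s ≤ 1 / 10) (hD : D = s ^ 2 * Z) (hD1 : 1 ≤ D)
    (hpal : ∀ v, maxDeg G + 1 ≤ (pal v).card)
    (hreg : ∀ v : DenseVertex G ε, χ v.1 = none → (antiDegree χ v : ℝ) ≤ D ∧
      (extDegree χ v : ℝ) ≤ D ∧ Z ≤ ((resPalette G pal χ v.1).card : ℝ)) :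
    (denseStep G ε pal ID leader (1 - 2 * s) χ).toOuterMeasure
      {χ' | ∀ v : DenseVertex G ε, χ v.1 = none →
        (antiDegree χ' v : ℝ) ≤ 12 * D * s ∧ (extDegree χ' v : ℝ) ≤ 12 * D * s ∧
        s * Z ≤ ((resPalette G pal χ' v.1).card : ℝ)}ᶜ
    ≤ ENNReal.ofReal (Fintype.card V * (2 * Real.exp (-(4 * (D * s))))) := by
  classical
  have hbad := tentativeLaw_forall_commit_eq_none_le_pow hID hleader hZ hs hs' hD hpal hreg
  set p := tentativeLaw G ε pal χ (1 - 2 * s)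
  set q := ENNReal.ofReal (Real.exp (-(4 * (D * s)))) with hq
  have hexp : Real.exp (-(12 * D * s / 3)) = Real.exp (-(4 * (D * s))) := by
    congr 1; ring
  set U : Finset (DenseVertex G ε) := Finset.univ.filter fun v => χ v.1 = none
  have hanti : ∀ v ∈ U,
      p.toOuterMeasure {A | 12 * D * s < (antiDegree (commit ID leader χ A) v : ℝ)} ≤ q := by
    intro v hv
    have hv := (Finset.mem_filter.1 hv).2
    rw [hq, ← hexp]
    refine toOuterMeasure_lt_card_filter_le_exp p
      ((resClique χ (cliqueOf v)).filter fun w => ¬ G.Adj v.1 w.1)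
      (fun A w => commit ID leader χ A w.1 = none) (3 * s) _ (by positivity) ?_ ?_ _ ?_
    · intro T hT
      refine hbad T fun w hw => ?_
      have := (Finset.mem_filter.1 (hT hw)).1
      exact (Finset.mem_filter.1 this).2.2
    · have h1 := (hreg v hv).1
      have h2 : ((((resClique χ (cliqueOf v)).filter fun w => ¬ G.Adj v.1 w.1).card : ℕ) : ℝ)
          ≤ D := by
        refine le_trans (le_of_eq ?_) h1
        unfold antiDegree; congr!
      nlinarith
    · intro A
      refine ⟨_, ?_, ?_, rfl⟩
      · intro w hw
        simp only [resClique, Finset.mem_filter, Finset.mem_univ, true_and] at hw ⊢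
        exact ⟨⟨hw.1.1, eq_none_of_commit_eq_none ID leader χ A hw.1.2⟩, hw.2⟩
      · intro w hw
        simp only [resClique, Finset.mem_filter, Finset.mem_univ, true_and] at hw
        exact hw.1.2
  have hext : ∀ v ∈ U,
      p.toOuterMeasure {A | 12 * D * s < (extDegree (commit ID leader χ A) v : ℝ)} ≤ q := by
    intro v hv
    have hv := (Finset.mem_filter.1 hv).2
    rw [hq, ← hexp]
    refine toOuterMeasure_lt_card_filter_le_exp p
      (Finset.univ.filter fun w : DenseVertex G ε =>
        χ w.1 = none ∧ G.Adj v.1 w.1 ∧ cliqueOf w ≠ cliqueOf v)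
      (fun A w => commit ID leader χ A w.1 = none) (3 * s) _ (by positivity) ?_ ?_ _ ?_
    · intro T hT
      exact hbad T fun w hw => (Finset.mem_filter.1 (hT hw)).2.1
    · have h1 := (hreg v hv).2.1
      have h2 : (((Finset.univ.filter fun w : DenseVertex G ε =>
          χ w.1 = none ∧ G.Adj v.1 w.1 ∧ cliqueOf w ≠ cliqueOf v).card : ℕ) : ℝ) ≤ D := by
        refine le_trans (le_of_eq ?_) h1
        unfold extDegree; congr!
      nlinarith
    · intro A
      refine ⟨_, ?_, ?_, rfl⟩
      · intro w hw
        simp only [Finset.mem_filter, Finset.mem_univ, true_and] at hw ⊢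
        exact ⟨eq_none_of_commit_eq_none ID leader χ A hw.1, hw.2⟩
      · intro w hw
        simp only [Finset.mem_filter, Finset.mem_univ, true_and] at hw
        exact hw.1
  rw [denseStep, PMF.toOuterMeasure_map_apply]
  calc _ ≤ p.toOuterMeasure (⋃ v ∈ U,
        ({A | 12 * D * s < (antiDegree (commit ID leader χ A) v : ℝ)} ∪
          {A | 12 * D * s < (extDegree (commit ID leader χ A) v : ℝ)})) := by
        refine PMF.toOuterMeasure_mono _ ?_
        rintro A ⟨hA, hsupp⟩
        simp only [Set.mem_preimage, Set.mem_compl_iff, Set.mem_ofPred_eq, not_forall] at hA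
        obtain ⟨v, hv, hA⟩ := hA
        simp only [Set.mem_iUnion]
        refine ⟨v, Finset.mem_filter.2 ⟨Finset.mem_univ _, hv⟩, ?_⟩
        by_contra h
        simp only [Set.mem_union, Set.mem_ofPred_eq, not_or, not_lt] at h
        obtain ⟨h1, h2, h3⟩ := hreg v hv
        exact hA ⟨h.1, h.2, le_card_resPalette_commit hZ hs hs' hD hD1 hpal h1 h2 h3 hsupp⟩
    _ ≤ ∑ v ∈ U, (q + q) := by
        refine (MeasureTheory.measure_biUnion_finset_le _ _).trans
          (Finset.sum_le_sum fun v hv => ?_)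
        exact (MeasureTheory.measure_union_le _ _).trans (add_le_add (hanti v hv) (hext v hv))
    _ ≤ _ := by
        rw [Finset.sum_const, nsmul_eq_mul, ENNReal.ofReal_mul (by positivity),
          ENNReal.ofReal_natCast, ENNReal.ofReal_mul (by norm_num), ← hq,
          ENNReal.ofReal_ofNat, two_mul]
        gcongr
        refine (Finset.card_le_univ U).trans ?_
        convert Fintype.card_subtype_le (fun v : V => IsDense G ε v)

end Main

end DenseColoring

theorem mainTheorem5 :
    ∀ K' : ℝ, 0 < K' → ∃ K₀ : ℝ, 0 < K₀ ∧ ∀ K : ℝ, K₀ ≤ K →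
      ∀ {V : Type*} {Col : Type*} [Fintype V] (G : SimpleGraph V)
        (ε : ℝ), 0 ≤ ε → ε ≤ 1 →
      ∀ (pal : V → Finset Col), (∀ v, DenseColoring.maxDeg G + 1 ≤ (pal v).card) →
      ∀ (ID : V → ℕ), Function.Injective ID →
      ∀ (leader : DenseColoring.AlmostClique G ε → DenseColoring.DenseVertex G ε),
        (∀ C, DenseColoring.cliqueOf (leader C) = C) →
      ∀ (χ : V → Option Col), DenseColoring.IsPartialColoring G pal χ →
      ∀ (D Z δ : ℝ), 0 < D → 0 < Z → δ = D / Z →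
        K * Real.log (Fintype.card V) ≤ D * δ → δ ≤ 1 / K →
        (∀ v : DenseColoring.DenseVertex G ε, χ v.1 = none →
          (DenseColoring.antiDegree χ v : ℝ) ≤ D ∧
          (DenseColoring.extDegree χ v : ℝ) ≤ D ∧
          Z ≤ ((DenseColoring.resPalette G pal χ v.1).card : ℝ)) →
        1 - (Fintype.card V : ℝ) ^ (-K') ≤
          ((DenseColoring.denseStep G ε pal ID leader (1 - 2 * √δ) χ).toOuterMeasure
            {χ' | ∀ v : DenseColoring.DenseVertex G ε, χ v.1 = none →
              (DenseColoring.antiDegree χ' v : ℝ) ≤ 12 * D * √δ ∧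
              (DenseColoring.extDegree χ' v : ℝ) ≤ 12 * D * √δ ∧
              D / √δ ≤ ((DenseColoring.resPalette G pal χ' v.1).card : ℝ)}).toReal := by
  intro K' hK'
  -- The summand 100 forces `√δ ≤ 1 / 10`; the summand `K'` pays for the target exponent.
  refine ⟨K' + 100, by linarith, ?_⟩
  intro K hK V Col _ G ε _ _ pal hpal ID hID leader hleader χ _ D Z δ hD hZ hδ hreg1 hreg2 hreg
  have hδ0 : 0 < δ := by rw [hδ]; positivity
  have hs : 0 < √δ := Real.sqrt_pos.2 hδ0
  have hsq : √δ ^ 2 = δ := Real.sq_sqrt hδ0.le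
  have hDs : D = √δ ^ 2 * Z := by rw [hsq, hδ]; field_simp
  have hK100 : 100 ≤ K := by linarith
  have hs' : √δ ≤ 1 / 10 := by
    rw [Real.sqrt_le_left (by norm_num)]
    exact hreg2.trans ((one_div_le_one_div_of_le (by norm_num) hK100).trans (by norm_num))
  have hDdiv : D / √δ = √δ * Z := by rw [div_eq_iff hs.ne', hDs]; ring
  -- With fewer than two vertices `log n` gives no lower bound on `D`. With none the event is
  -- vacuous, and with one the claimed lower bound is `0`.
  rcases Nat.lt_or_ge (Fintype.card V) 2 with hn | hn
  · rcases Nat.lt_or_ge (Fintype.card V) 1 with hn' | hn'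
    · have hn0 : Fintype.card V = 0 := by omega
      have : IsEmpty V := Fintype.card_eq_zero_iff.1 hn0
      rw [(PMF.toOuterMeasure_apply_eq_one_iff _ _).2 fun χ' _ v => this.elim v.1]
      simp only [ENNReal.toReal_one]
      have : (0 : ℝ) ≤ (Fintype.card V : ℝ) ^ (-K') := by positivity
      linarith
    · have hn1 : Fintype.card V = 1 := by omega
      rw [hn1]
      simp
  · have hn : (2 : ℝ) ≤ Fintype.card V := by exact_mod_cast hn
    have hD1 := DenseColoring.one_le_of_log_le hn hK100 hreg2 hD hreg1
    have hfail := DenseColoring.toOuterMeasure_failure_le (ε := ε) hID hleader hZ hs hs' hDs hD1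
      hpal hreg
    rw [hDdiv]
    refine le_trans ?_ (DenseColoring.one_sub_toOuterMeasure_compl_le _ _)
    refine sub_le_sub_left ((ENNReal.toReal_le_of_le_ofReal (by positivity) hfail).trans
      (DenseColoring.mul_exp_le_rpow hn hK100 (by linarith) (hreg1.trans ?_))) 1
    gcongr
    -- This is `δ ≤ √δ`, which turns the hypothesis on `D * δ` into a bound on `D * √δ`.
    nlinarith
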